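/- **Setting.** Let $\mathcal V=(\mathcal V,\otimes,k)$ be a commutative unital quantale with internal hom $\hom$, and let $(\mathbb T,\mathcal V,\xi)$ be a (strict) topological theory with $T1=1$. That is: $\mathbb T=(T,e,m)$ is a monad on $\mathsf{Set}$ such that $T$ preserves weak pullbacks and every naturality square of $m$ is a weak pullback; $\xi:T\mathcal V\to\mathcal V$ is an Eilenberg--Moore algebra for $\mathbb T$ for which $\otimes:\mathcal V\times\mathcal V\to\mathcal V$ and $k:1\to\mathcal V$ are $\mathbb T$-homomorphisms; and the maps $\mathcal V^X\to\mathcal V^{TX}$, $\varphi\mapsto\xi\cdot T\varphi$, are monotone and natural in $X$ with respect to direct images, i.e. $\xi\cdot T(f_!\varphi)=(Tf)_!(\xi\cdot T\varphi)$ for all $f:X\to Y$ and $\varphi:X\to\mathcal V$, where $f_!\varphi(y)=\bigvee_{f(x)=y}\varphi(x)$. A $\mathcal V$-relation $r:X\nrightarrow Y$ is a map $r:X\times Y\to\mathcal V$. Composition is $(s\cdot r)(x,z)=\bigvee_y r(x,y)\otimes s(y,z)$, functions are regarded as $\mathcal V$-relations via their graphs, $r^\circ(y,x)=r(x,y)$,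 and $T_\xi r:TX\nrightarrow TY$ is $$T_\xi r(\mathfrak x,\mathfrak y)=\bigvee\{\xi(Tr(\mathfrak w))\mid \mathfrak w\in T(X\times Y),\ T\pi_1(\mathfrak w)=\mathfrak x,\ T\pi_2(\mathfrak w)=\mathfrak y\}.$$ A $\mathbb T$-category $X=(X,a)$ is a set $X$ with $a:TX\nrightarrow X$ such that $k\le a(e_X(x),x)$ and $T_\xi a(\mathfrak X,\mathfrak x)\otimes a(\mathfrak x,x)\le a(m_X(\mathfrak X),x)$. A $\mathbb T$-functor $f:(X,a)\to(Y,b)$ is a map with $a(\mathfrak x,x)\le b(Tf(\mathfrak x),f(x))$. Write $X_0=(X,a_0)$, $a_0=a\cdot e_X$, for the underlying $\mathcal V$-category. For maps $f,g$ into $(Y,b)$ put $f\le g$ iff $k\le b_0(f(x),g(x))$ for all $x$, and $f\simeq g$ iff $f\le g\le f$. The $\mathbb T$-category $TX$ is $(TX,T_\xi a\cdot m_X^\circ\cdot m_X)$. $X$ is *representable* if there is a $\mathbb T$-functor $\alpha:TX\to X$ left adjoint to $e_X:X\to TX$ (that is, $1_{TX}\le e_X\cdot\alpha$ and $\alpha\cdot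 e_X\le 1_X$). A *pseudo-homomorphism* between representable $\mathbb T$-categories, with such left adjoints $\alpha,\beta$, is a $\mathbb T$-functor $f:X\to Y$ with $\beta\cdot Tf\simeq f\cdot\alpha$. These form the category $\mathsf{Repr}(\mathbb T)$. **The monad $\mathbb V=(V,y,w)$ on $\mathsf{Repr}(\mathbb T)$.** The underlying set of $VX$ is the set of $\mathbb T$-functors $\varphi:(X,a)\to(\mathcal V,\hom_\xi)$, $\hom_\xi(\mathfrak v,v)=\hom(\xi(\mathfrak v),v)$. The structure of $VX=(\mathcal V^X)^{\mathrm{op}}$ is $(\mathfrak p,\varphi)\mapsto\bigwedge_{x}\hom(\varphi(x),\mu_X(\mathfrak p,x))$, where $\mu_X=a\cdot T_\xi\mathrm{ev}$ and $\mathrm{ev}(\varphi,x)=\varphi(x)$. For $\psi:TX\nrightarrow Y$ and $\varphi:X\to\mathcal V$ put $(\psi\circ\varphi)(y)=\bigvee_{\mathfrak x\in TX}\xi(T\varphi(\mathfrak x))\otimes\psi(\mathfrak x,y)$. For $f:X\to(Y,b)$, $Vf(\varphi)=f_\circledast\circ\varphi$ with $f_\circledast(\mathfrak x,y)=b(Tf(\mathfrak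 x),y)$. The unit is $y_X(x)=a_0(x,-)$, and the multiplication is $w_X(\Phi)=y_X^\circledast\circ\Phi$, where $y_X^\circledast(\mathfrak p,x)$ is the value of the structure of $VX$ at $(\mathfrak p,y_X(x))$. **The category $\mathsf{ReprDist}(\mathbb T)$.** Its objects are the representable $\mathbb T$-categories. A morphism $(X,a)\to(Y,b)$ is a $\mathcal V$-distributor $\psi:X_0\to Y_0$ (a $\mathcal V$-relation $\psi:X\nrightarrow Y$ with $\psi\cdot a_0\le\psi$ and $b_0\cdot\psi\le\psi$) such that $\psi\cdot a=b\cdot T_\xi\psi$. Composition is composition of $\mathcal V$-relations, and the identity on $X$ is $a_0$. **Theorem.** The Kleisli category $\mathsf{Repr}(\mathbb T)_{\mathbb V}$ of $\mathbb V$ is equivalent to $\mathsf{ReprDist}(\mathbb T)$. More precisely, there is an equivalence of categories $\mathsf{Repr}(\mathbb T)_{\mathbb V}\to\mathsf{ReprDist}(\mathbb T)$ which is the identity on objects and sends a morphism $r:X\to VY$ to the $\mathcal V$-relation $\bar r$ with $\bar r(x,y)=r(x)(y)$. -/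

import Mathlib

open CategoryTheory

universe u

/-! ## Quantale-valued relations -/

section DirectImage

variable {V : Type u} [CompleteLattice V]

/-- The left adjoint of the inverse image function `(Y → V) → (X → V)`, `φ ↦ φ ∘ f`. -/
def directImage {X Y : Type u} (f : X → Y) (φ : X → V) : Y → V :=
  fun y => ⨆ (x : X) (_ : f x = y), φ x

theorem directImage_le_iff {X Y : Type u} (f : X → Y) (φ : X → V) (ψ : Y → V) :
    directImage f φ ≤ ψ ↔ φ ≤ ψ ∘ f := by
  constructor
  · intro h x
    exact (le_iSup₂ (f := fun (x' : X) (_ : f x' = f x) => φ x') x rfl).trans (h (f x))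
  · intro h y
    refine iSup₂_le ?_
    rintro x rfl
    exact h x

end DirectImage

section Relations

variable {V : Type u} [CommMonoid V] [CompleteLattice V]

/-- The composite `s · r` of the `V`-relations `r : X ⇸ Y` and `s : Y ⇸ Z`. -/
def relComp {X Y Z : Type u} (s : Y → Z → V) (r : X → Y → V) : X → Z → V :=
  fun x z => ⨆ y, r x y * s y z

theorem le_relComp {X Y Z : Type u} {s : Y → Z → V} {r : X → Y → V} {x : X} {z : Z} (y : Y) :
    r x y * s y z ≤ relComp s r x z :=
  le_iSup (fun y => r x y * s y z) y

/-- `ψ : X ⇸ Y` is a `V`-distributor from `(X, a)` to `(Y, b)`: `ψ · a ≤ ψ` and `b · ψ ≤ ψ`. -/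
def IsVDistributor {X Y : Type u} (a : X → X → V) (b : Y → Y → V) (ψ : X → Y → V) : Prop :=
  relComp ψ a ≤ ψ ∧ relComp b ψ ≤ ψ

variable [IsQuantale V]

/-- The internal hom of the quantale: `x * y ≤ z ↔ x ≤ ihom y z`. -/
def ihom (y z : V) : V := Quantale.leftMulResiduation y z

theorem le_ihom {x y z : V} : x ≤ ihom y z ↔ x * y ≤ z :=
  Quantale.leftMulResiduation_le_iff_mul_le

theorem ihom_mul_le (y z : V) : ihom y z * y ≤ z := le_ihom.1 le_rfl

theorem qSup_mul_le {ι : Type u} {p : ι → Prop} {f : ι → V} {y z : V}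
    (h : ∀ i, p i → f i * y ≤ z) : (⨆ (i : ι) (_ : p i), f i) * y ≤ z :=
  le_ihom.1 (iSup₂_le fun i hi => le_ihom.2 (h i hi))

theorem mul_qSup_le {ι : Type u} {p : ι → Prop} {f : ι → V} {y z : V}
    (h : ∀ i, p i → y * f i ≤ z) : y * (⨆ (i : ι) (_ : p i), f i) ≤ z := by
  rw [mul_comm]
  exact qSup_mul_le fun i hi => (mul_comm _ _).trans_le (h i hi)

theorem relComp_mono {X Y Z : Type u} {s s' : Y → Z → V} {r r' : X → Y → V}
    (hs : s ≤ s') (hr : r ≤ r') : relComp s r ≤ relComp s' r' :=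
  fun x z => iSup_mono fun y => mul_le_mul' (hr x y) (hs y z)

theorem relComp_assoc {W X Y Z : Type u} (t : Y → Z → V) (s : X → Y → V) (r : W → X → V) :
    relComp t (relComp s r) = relComp (relComp t s) r := by
  funext w z
  simp only [relComp, Quantale.iSup_mul_distrib, Quantale.mul_iSup_distrib, mul_assoc]
  exact iSup_comm

end Relations

/-! ## Topological theories -/

/-- The square `f ∘ p = g ∘ q` of sets and functions is a weak pullback. -/
def IsWeakPullback {P A B C : Type u} (p : P → A) (q : P → B) (f : A → C) (g : B → C) : Prop :=
  f ∘ p = g ∘ q ∧ ∀ a b, f a = g b → ∃ x, p x = a ∧ q x = b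

/-- A (strict) topological theory over the commutative unital quantale `V`. -/
structure TopologicalTheory (V : Type u) [CommMonoid V] [CompleteLattice V] [IsQuantale V] where
  /-- the monad `(T, e, m)` on the category of sets -/
  monad : CategoryTheory.Monad (Type u)
  /-- the algebra structure on `V` -/
  ξ : monad.obj V → V
  preserves_weakPullback : ∀ {P A B C : Type u} (p : P → A) (q : P → B) (f : A → C) (g : B → C),
    IsWeakPullback p q f g →
      IsWeakPullback (monad.map (↾p)) (monad.map (↾q)) (monad.map (↾f)) (monad.map (↾g))
  mu_weakPullback : ∀ {X Y : Type u} (f : X → Y),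
    IsWeakPullback (monad.μ.app X) (monad.map (monad.map (↾f))) (monad.map (↾f)) (monad.μ.app Y)
  ξ_unit : ∀ v : V, ξ (monad.η.app V v) = v
  ξ_mult : ∀ w : monad.obj (monad.obj V), ξ (monad.map (↾ξ) w) = ξ (monad.μ.app V w)
  ξ_mul : ∀ w : monad.obj (V × V), ξ (monad.map (↾fun p : V × V => p.1 * p.2) w) =
    ξ (monad.map (↾(Prod.fst : V × V → V)) w) * ξ (monad.map (↾(Prod.snd : V × V → V)) w)
  ξ_one : ∀ t : monad.obj PUnit, ξ (monad.map (↾fun _ : PUnit => (1 : V)) t) = 1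
  ξ_mono : ∀ {X : Type u} (φ ψ : X → V), φ ≤ ψ →
    ∀ w : monad.obj X, ξ (monad.map (↾φ) w) ≤ ξ (monad.map (↾ψ) w)
  ξ_directImage : ∀ {X Y : Type u} (f : X → Y) (φ : X → V),
    (fun w : monad.obj Y => ξ (monad.map (↾directImage f φ) w)) =
      directImage (fun w : monad.obj X => monad.map (↾f) w) (fun w => ξ (monad.map (↾φ) w))

namespace TopologicalTheory

variable {V : Type u} [CommMonoid V] [CompleteLattice V] [IsQuantale V]
variable (𝕋 : TopologicalTheory V)

/-- The set `TX`. -/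
abbrev F (X : Type u) : Type u := 𝕋.monad.obj X

/-- The function `Tf : TX → TY`. -/
def map {X Y : Type u} (f : X → Y) (w : 𝕋.F X) : 𝕋.F Y := 𝕋.monad.map (↾f) w

/-- The unit `e : X → TX`. -/
def e {X : Type u} (x : X) : 𝕋.F X := 𝕋.monad.η.app X x

/-- The multiplication `m : TTX → TX`. -/
def m {X : Type u} (w : 𝕋.F (𝕋.F X)) : 𝕋.F X := 𝕋.monad.μ.app X w

theorem map_id {X : Type u} (w : 𝕋.F X) : 𝕋.map (fun x => x) w = w := by
  have h : (↾fun x : X => x) = 𝟙 X := rfl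
  simp [map, h]

theorem map_map {X Y Z : Type u} (f : X → Y) (g : Y → Z) (w : 𝕋.F X) :
    𝕋.map g (𝕋.map f w) = 𝕋.map (fun x => g (f x)) w := by
  have h : (↾fun x : X => g (f x)) = (↾f) ≫ (↾g) := rfl
  simp [map, h]

theorem map_e {X Y : Type u} (f : X → Y) (x : X) : 𝕋.map f (𝕋.e x) = 𝕋.e (f x) :=
  (ConcreteCategory.congr_hom (𝕋.monad.η.naturality (↾f)) x).symm

theorem map_m {X Y : Type u} (f : X → Y) (w : 𝕋.F (𝕋.F X)) :
    𝕋.map f (𝕋.m w) = 𝕋.m (𝕋.map (𝕋.map f) w) :=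
  (ConcreteCategory.congr_hom (𝕋.monad.μ.naturality (↾f)) w).symm

theorem m_e {X : Type u} (w : 𝕋.F X) : 𝕋.m (𝕋.e w) = w :=
  ConcreteCategory.congr_hom (𝕋.monad.left_unit X) w

theorem m_map_e {X : Type u} (w : 𝕋.F X) : 𝕋.m (𝕋.map 𝕋.e w) = w :=
  ConcreteCategory.congr_hom (𝕋.monad.right_unit X) w

theorem m_map_m {X : Type u} (w : 𝕋.F (𝕋.F (𝕋.F X))) : 𝕋.m (𝕋.map 𝕋.m w) = 𝕋.m (𝕋.m w) :=
  ConcreteCategory.congr_hom (𝕋.monad.assoc X) w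

/-! ## The extension of `T` to `V`-relations -/

/-- The `V`-relation `T_ξ r : TX ⇸ TY` for `r : X ⇸ Y`. -/
def ext {X Y : Type u} (r : X → Y → V) : 𝕋.F X → 𝕋.F Y → V :=
  fun 𝔵 𝔶 => ⨆ (w : 𝕋.F (X × Y)) (_ : 𝕋.map Prod.fst w = 𝔵 ∧ 𝕋.map Prod.snd w = 𝔶),
    𝕋.ξ (𝕋.map (fun p => r p.1 p.2) w)

theorem le_ext {X Y : Type u} (r : X → Y → V) (w : 𝕋.F (X × Y)) :
    𝕋.ξ (𝕋.map (fun p => r p.1 p.2) w) ≤ 𝕋.ext r (𝕋.map Prod.fst w) (𝕋.map Prod.snd w) :=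
  le_iSup₂ (f := fun (w' : 𝕋.F (X × Y)) (_ : 𝕋.map Prod.fst w' = 𝕋.map Prod.fst w ∧
    𝕋.map Prod.snd w' = 𝕋.map Prod.snd w) => 𝕋.ξ (𝕋.map (fun p => r p.1 p.2) w')) w ⟨rfl, rfl⟩

theorem ext_le {X Y : Type u} {r : X → Y → V} {s : 𝕋.F X → 𝕋.F Y → V}
    (h : ∀ w : 𝕋.F (X × Y), 𝕋.ξ (𝕋.map (fun p => r p.1 p.2) w) ≤
      s (𝕋.map Prod.fst w) (𝕋.map Prod.snd w)) : 𝕋.ext r ≤ s := by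
  intro 𝔵 𝔶
  refine iSup₂_le ?_
  rintro w ⟨rfl, rfl⟩
  exact h w

theorem ξ_map_mono {X : Type u} {φ ψ : X → V} (h : φ ≤ ψ) (w : 𝕋.F X) :
    𝕋.ξ (𝕋.map φ w) ≤ 𝕋.ξ (𝕋.map ψ w) := 𝕋.ξ_mono φ ψ h w

theorem ξ_map_mul {X : Type u} (φ ψ : X → V) (w : 𝕋.F X) :
    𝕋.ξ (𝕋.map (fun x => φ x * ψ x) w) = 𝕋.ξ (𝕋.map φ w) * 𝕋.ξ (𝕋.map ψ w) := by
  have h := 𝕋.ξ_mul (𝕋.map (fun x => (φ x, ψ x)) w)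
  change 𝕋.ξ (𝕋.map _ (𝕋.map _ w)) = 𝕋.ξ (𝕋.map _ (𝕋.map _ w)) * 𝕋.ξ (𝕋.map _ (𝕋.map _ w)) at h
  simpa only [map_map] using h

theorem ξ_map_one {X : Type u} (w : 𝕋.F X) : 𝕋.ξ (𝕋.map (fun _ => (1 : V)) w) = 1 := by
  have h := 𝕋.ξ_one (𝕋.map (fun _ => PUnit.unit) w)
  change 𝕋.ξ (𝕋.map _ (𝕋.map _ w)) = 1 at h
  simpa only [map_map] using h

theorem ξ_map_ξ {X : Type u} (φ : X → V) (w : 𝕋.F (𝕋.F X)) :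
    𝕋.ξ (𝕋.map (fun v => 𝕋.ξ (𝕋.map φ v)) w) = 𝕋.ξ (𝕋.map φ (𝕋.m w)) := by
  have h := 𝕋.ξ_mult (𝕋.map (𝕋.map φ) w)
  change 𝕋.ξ (𝕋.map _ (𝕋.map _ w)) = 𝕋.ξ (𝕋.m (𝕋.map _ w)) at h
  rw [map_map, ← map_m] at h
  exact h

theorem ξ_map_e {X : Type u} (φ : X → V) (x : X) : 𝕋.ξ (𝕋.map φ (𝕋.e x)) = φ x := by
  rw [map_e]
  exact 𝕋.ξ_unit _

theorem ξ_map_directImage {X Y : Type u} (f : X → Y) (φ : X → V) (w : 𝕋.F Y) :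
    𝕋.ξ (𝕋.map (directImage f φ) w) =
      ⨆ (v : 𝕋.F X) (_ : 𝕋.map f v = w), 𝕋.ξ (𝕋.map φ v) :=
  congrFun (𝕋.ξ_directImage f φ) w

theorem exists_of_weakPullback {P A B C : Type u} {p : P → A} {q : P → B} {f : A → C} {g : B → C}
    (h : IsWeakPullback p q f g) (a : 𝕋.F A) (b : 𝕋.F B) (hab : 𝕋.map f a = 𝕋.map g b) :
    ∃ x, 𝕋.map p x = a ∧ 𝕋.map q x = b :=
  (𝕋.preserves_weakPullback p q f g h).2 a b hab

theorem ext_mono {X Y : Type u} {r s : X → Y → V} (h : r ≤ s) : 𝕋.ext r ≤ 𝕋.ext s :=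
  𝕋.ext_le fun w => (𝕋.ξ_map_mono (fun p : X × Y => h p.1 p.2) w).trans (𝕋.le_ext s w)

theorem ext_comp {X Y Z : Type u} (s : Y → Z → V) (r : X → Y → V) :
    𝕋.ext (relComp s r) = relComp (𝕋.ext s) (𝕋.ext r) := by
  have key : (fun p : X × Z => relComp s r p.1 p.2) =
      directImage (fun t : X × Y × Z => (t.1, t.2.2)) (fun t => r t.1 t.2.1 * s t.2.1 t.2.2) := by
    funext p
    apply le_antisymm
    · refine iSup_le fun y => ?_
      exact le_iSup₂ (f := fun (t : X × Y × Z) (_ : (t.1, t.2.2) = p) =>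
        r t.1 t.2.1 * s t.2.1 t.2.2) (p.1, y, p.2) rfl
    · refine iSup₂_le ?_
      rintro t rfl
      exact le_relComp (s := s) (r := r) t.2.1
  apply le_antisymm
  · refine 𝕋.ext_le fun w => ?_
    rw [key, ξ_map_directImage]
    refine iSup₂_le ?_
    rintro t rfl
    rw [ξ_map_mul (φ := fun t : X × Y × Z => r t.1 t.2.1) (ψ := fun t => s t.2.1 t.2.2)]
    have h1 := 𝕋.le_ext r (𝕋.map (fun t : X × Y × Z => (t.1, t.2.1)) t)
    have h2 := 𝕋.le_ext s (𝕋.map (fun t : X × Y × Z => (t.2.1, t.2.2)) t)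
    simp only [map_map] at h1 h2 ⊢
    exact (mul_le_mul' h1 h2).trans (le_relComp _)
  · intro 𝔵 𝔷
    refine iSup_le fun 𝔶 => ?_
    refine qSup_mul_le ?_
    rintro w ⟨rfl, rfl⟩
    refine mul_qSup_le ?_
    rintro v ⟨hv, rfl⟩
    obtain ⟨t, rfl, rfl⟩ := 𝕋.exists_of_weakPullback
      (p := fun t : X × Y × Z => (t.1, t.2.1)) (q := fun t : X × Y × Z => (t.2.1, t.2.2))
      (f := Prod.snd) (g := Prod.fst)
      ⟨rfl, by rintro ⟨x, y⟩ ⟨y', z⟩ (rfl : y = y'); exact ⟨(x, y, z), rfl, rfl⟩⟩ w v hv.symm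
    have h := 𝕋.le_ext (relComp s r) (𝕋.map (fun t : X × Y × Z => (t.1, t.2.2)) t)
    refine le_trans ?_ (h.trans_eq ?_)
    · simp only [map_map]
      rw [← ξ_map_mul (φ := fun t : X × Y × Z => r t.1 t.2.1) (ψ := fun t => s t.2.1 t.2.2)]
      exact 𝕋.ξ_map_mono (fun t : X × Y × Z => le_relComp (s := s) (r := r) t.2.1) t
    · simp only [map_map]

/-- `T_ξ` commutes with precomposition by functions in the first variable. -/
theorem ext_precomp {X Y Z : Type u} (s : Y → Z → V) (f : X → Y) (𝔵 : 𝕋.F X) (𝔷 : 𝕋.F Z) :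
    𝕋.ext (fun x z => s (f x) z) 𝔵 𝔷 = 𝕋.ext s (𝕋.map f 𝔵) 𝔷 := by
  apply le_antisymm
  · refine iSup₂_le ?_
    rintro w ⟨rfl, rfl⟩
    have h := 𝕋.le_ext s (𝕋.map (fun p : X × Z => (f p.1, p.2)) w)
    simp only [map_map] at h ⊢
    exact h
  · refine iSup₂_le ?_
    rintro w ⟨hw, rfl⟩
    obtain ⟨t, rfl, rfl⟩ := 𝕋.exists_of_weakPullback
      (p := fun p : X × Z => (f p.1, p.2)) (q := Prod.fst) (f := Prod.fst) (g := f)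
      ⟨rfl, by rintro ⟨y, z⟩ x (rfl : y = f x); exact ⟨(x, z), rfl, rfl⟩⟩ w 𝔵 hw
    have h := 𝕋.le_ext (fun x z => s (f x) z) t
    simp only [map_map] at h ⊢
    exact h

theorem ext_swap {X Y : Type u} (r : X → Y → V) (𝔵 : 𝕋.F X) (𝔶 : 𝕋.F Y) :
    𝕋.ext (fun y x => r x y) 𝔶 𝔵 = 𝕋.ext r 𝔵 𝔶 := by
  apply le_antisymm
  · refine iSup₂_le ?_
    rintro w ⟨rfl, rfl⟩
    have h := 𝕋.le_ext r (𝕋.map Prod.swap w)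
    simp only [map_map] at h ⊢
    exact h
  · refine iSup₂_le ?_
    rintro w ⟨rfl, rfl⟩
    have h := 𝕋.le_ext (fun y x => r x y) (𝕋.map Prod.swap w)
    simp only [map_map] at h ⊢
    exact h

theorem le_ext_e {X Y : Type u} (r : X → Y → V) (x : X) (y : Y) :
    r x y ≤ 𝕋.ext r (𝕋.e x) (𝕋.e y) := by
  have h := 𝕋.le_ext r (𝕋.e (x, y))
  rwa [ξ_map_e, map_e, map_e] at h

theorem one_le_ext_refl {X : Type u} {r : X → X → V} (h : ∀ x, 1 ≤ r x x) (𝔵 : 𝕋.F X) :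
    1 ≤ 𝕋.ext r 𝔵 𝔵 := by
  have h1 := 𝕋.le_ext r (𝕋.map (fun x => (x, x)) 𝔵)
  simp only [map_map, map_id] at h1
  refine le_trans ?_ h1
  rw [← 𝕋.ξ_map_one 𝔵]
  exact 𝕋.ξ_map_mono h 𝔵

theorem ξ_map_ext {X Y : Type u} (r : X → Y → V) (W : 𝕋.F (𝕋.F X × 𝕋.F Y)) :
    𝕋.ξ (𝕋.map (fun p => 𝕋.ext r p.1 p.2) W) =
      ⨆ (U : 𝕋.F (𝕋.F (X × Y)))
        (_ : 𝕋.map (fun w => (𝕋.map Prod.fst w, 𝕋.map Prod.snd w)) U = W),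
        𝕋.ξ (𝕋.map (fun p => r p.1 p.2) (𝕋.m U)) := by
  have key : (fun p : 𝕋.F X × 𝕋.F Y => 𝕋.ext r p.1 p.2) =
      directImage (fun w => (𝕋.map Prod.fst w, 𝕋.map Prod.snd w))
        (fun w => 𝕋.ξ (𝕋.map (fun p : X × Y => r p.1 p.2) w)) := by
    funext p
    simp only [ext, directImage, Prod.ext_iff]
  rw [key, ξ_map_directImage]
  simp only [ξ_map_ξ]

theorem ext_ext_le {X Y : Type u} (r : X → Y → V) (𝔛 : 𝕋.F (𝕋.F X)) (𝔜 : 𝕋.F (𝕋.F Y)) :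
    𝕋.ext (𝕋.ext r) 𝔛 𝔜 ≤ 𝕋.ext r (𝕋.m 𝔛) (𝕋.m 𝔜) := by
  refine 𝕋.ext_le (s := fun 𝔛 𝔜 => 𝕋.ext r (𝕋.m 𝔛) (𝕋.m 𝔜)) (fun W => ?_) 𝔛 𝔜
  rw [ξ_map_ext]
  refine iSup₂_le ?_
  rintro U rfl
  refine (𝕋.le_ext r _).trans_eq ?_
  simp only [map_map, map_m]

theorem ext_m_le {X Y : Type u} (r : X → Y → V) (𝔛 : 𝕋.F (𝕋.F X)) (𝔶 : 𝕋.F Y) :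
    𝕋.ext r (𝕋.m 𝔛) 𝔶 ≤ ⨆ (𝔜 : 𝕋.F (𝕋.F Y)) (_ : 𝕋.m 𝔜 = 𝔶), 𝕋.ext (𝕋.ext r) 𝔛 𝔜 := by
  refine iSup₂_le ?_
  rintro w ⟨hw, rfl⟩
  obtain ⟨U, rfl, hU⟩ := (𝕋.mu_weakPullback (Prod.fst : X × Y → X)).2 w 𝔛 hw
  change 𝕋.map (𝕋.map Prod.fst) U = 𝔛 at hU
  change 𝕋.ξ (𝕋.map _ (𝕋.m U)) ≤ ⨆ (𝔜) (_ : 𝕋.m 𝔜 = 𝕋.map Prod.snd (𝕋.m U)), _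
  refine le_trans ?_ (le_iSup₂ (f := fun (𝔜 : 𝕋.F (𝕋.F Y))
    (_ : 𝕋.m 𝔜 = 𝕋.map Prod.snd (𝕋.m U)) => 𝕋.ext (𝕋.ext r) 𝔛 𝔜)
    (𝕋.map (𝕋.map Prod.snd) U) (𝕋.map_m _ _).symm)
  have h := 𝕋.le_ext (𝕋.ext r) (𝕋.map (fun w => (𝕋.map Prod.fst w, 𝕋.map Prod.snd w)) U)
  simp only [map_map] at h
  change _ ≤ 𝕋.ext (𝕋.ext r) (𝕋.map (𝕋.map Prod.fst) U) (𝕋.map (𝕋.map Prod.snd) U) at h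
  rw [hU] at h
  refine le_trans ?_ h
  have h2 := 𝕋.ξ_map_ext r (𝕋.map (fun w => (𝕋.map Prod.fst w, 𝕋.map Prod.snd w)) U)
  simp only [map_map] at h2
  rw [h2]
  exact le_iSup₂ (f := fun (U' : 𝕋.F (𝕋.F (X × Y)))
    (_ : 𝕋.map (fun w => (𝕋.map Prod.fst w, 𝕋.map Prod.snd w)) U' =
      𝕋.map (fun w => (𝕋.map Prod.fst w, 𝕋.map Prod.snd w)) U) =>
        𝕋.ξ (𝕋.map (fun p : X × Y => r p.1 p.2) (𝕋.m U'))) U rfl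

theorem relComp_ext_ext_le {A X Y Z : Type u} {χ : 𝕋.F Y → Z → V} {ψ : 𝕋.F X → Y → V}
    {ρ : 𝕋.F X → Z → V} (h : ∀ 𝔛 z, relComp χ (𝕋.ext ψ) 𝔛 z ≤ ρ (𝕋.m 𝔛) z) (s : A → X → V)
    (𝔄 : 𝕋.F (𝕋.F A)) (z : Z) :
    relComp χ (𝕋.ext (relComp ψ (𝕋.ext s))) 𝔄 z ≤ relComp ρ (𝕋.ext s) (𝕋.m 𝔄) z := by
  rw [ext_comp, relComp_assoc]
  refine iSup_le fun 𝔛 => ?_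
  exact (mul_le_mul' (𝕋.ext_ext_le s 𝔄 𝔛) (h 𝔛 z)).trans (le_relComp _)

theorem le_relComp_ext_ext {A X Y Z : Type u} {χ : 𝕋.F Y → Z → V} {ψ : 𝕋.F X → Y → V}
    {ρ : 𝕋.F X → Z → V} (h : ∀ 𝔛 z, ρ (𝕋.m 𝔛) z ≤ relComp χ (𝕋.ext ψ) 𝔛 z) (s : A → X → V)
    (𝔄 : 𝕋.F (𝕋.F A)) (z : Z) :
    relComp ρ (𝕋.ext s) (𝕋.m 𝔄) z ≤ relComp χ (𝕋.ext (relComp ψ (𝕋.ext s))) 𝔄 z := by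
  rw [ext_comp, relComp_assoc]
  refine iSup_le fun 𝔵 => ?_
  refine (mul_le_mul_left (𝕋.ext_m_le s 𝔄 𝔵) (ρ 𝔵 z)).trans ?_
  refine qSup_mul_le ?_
  rintro 𝔛 rfl
  exact (mul_le_mul_right (h 𝔛 z) (𝕋.ext (𝕋.ext s) 𝔄 𝔛)).trans (le_relComp _)

/-- If `T1 = 1`, then `T_ξ r (e x, -) = ξ · T (r (x, -))`. -/
theorem ext_e [Subsingleton (𝕋.F PUnit.{u + 1})] {X Y : Type u} (r : X → Y → V) (x : X)
    (𝔶 : 𝕋.F Y) : 𝕋.ext r (𝕋.e x) 𝔶 = 𝕋.ξ (𝕋.map (r x) 𝔶) := by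
  have hconst : ∀ {A : Type u} (w : 𝕋.F A), 𝕋.map (fun _ => x) w = 𝕋.e x := by
    intro A w
    have h1 : 𝕋.map (fun _ : A => PUnit.unit.{u + 1}) w = 𝕋.e PUnit.unit :=
      Subsingleton.elim _ _
    have h2 := congrArg (𝕋.map (fun _ : PUnit.{u + 1} => x)) h1
    rwa [map_map, map_e] at h2
  apply le_antisymm
  · have h := 𝕋.ext_precomp r (fun _ : PUnit.{u + 1} => x) (𝕋.e PUnit.unit) 𝔶
    rw [map_e] at h
    rw [← h]
    refine iSup₂_le ?_
    rintro w ⟨-, rfl⟩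
    rw [map_map]
  · have h := 𝕋.le_ext r (𝕋.map (fun y => (x, y)) 𝔶)
    simp only [map_map, map_id, hconst] at h
    exact h

/-! ## `𝕋`-categories and `𝕋`-functors -/

/-- The underlying `V`-relation `a₀ = a · e` of a `𝕋`-relation `a`. -/
def under {X Y : Type u} (a : 𝕋.F X → Y → V) : X → Y → V := fun x y => a (𝕋.e x) y

/-- `f` is a `𝕋`-functor (a morphism of `𝕋`-graphs) from `(X, a)` to `(Y, b)`. -/
def IsTFunctor {X Y : Type u} (a : 𝕋.F X → X → V) (b : 𝕋.F Y → Y → V) (f : X → Y) : Prop :=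
  ∀ 𝔵 x, a 𝔵 x ≤ b (𝕋.map f 𝔵) (f x)

/-- A `𝕋`-category. -/
structure TCat where
  carrier : Type u
  str : 𝕋.F carrier → carrier → V
  refl : ∀ x, 1 ≤ str (𝕋.e x) x
  trans : ∀ 𝔛 𝔵 x, 𝕋.ext str 𝔛 𝔵 * str 𝔵 x ≤ str (𝕋.m 𝔛) x

variable {𝕋}

namespace TCat

variable (X : TCat 𝕋)

/-- The structure `a₀` of the underlying `V`-category. -/
abbrev str₀ : X.carrier → X.carrier → V := 𝕋.under X.str

theorem comp_le (𝔛 : 𝕋.F (𝕋.F X.carrier)) (x : X.carrier) :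
    relComp X.str (𝕋.ext X.str) 𝔛 x ≤ X.str (𝕋.m 𝔛) x :=
  iSup_le fun 𝔵 => X.trans 𝔛 𝔵 x

theorem str_mul_str₀ (𝔵 : 𝕋.F X.carrier) (x y : X.carrier) :
    X.str 𝔵 x * X.str₀ x y ≤ X.str 𝔵 y := by
  have h := X.trans (𝕋.e 𝔵) (𝕋.e x) y
  rw [m_e] at h
  exact (mul_le_mul_left (𝕋.le_ext_e X.str 𝔵 x) _).trans h

theorem ext_str₀_mul_str (𝔵 𝔶 : 𝕋.F X.carrier) (y : X.carrier) :
    𝕋.ext X.str₀ 𝔵 𝔶 * X.str 𝔶 y ≤ X.str 𝔵 y := by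
  have h := X.trans (𝕋.map 𝕋.e 𝔵) 𝔶 y
  rw [m_map_e, ← ext_precomp] at h
  exact h

theorem relComp_str₀_str : relComp X.str₀ X.str = X.str := by
  apply le_antisymm
  · exact fun 𝔵 y => iSup_le fun x => X.str_mul_str₀ 𝔵 x y
  · intro 𝔵 y
    refine le_trans ?_ (le_relComp y)
    exact le_mul_of_one_le_right' (X.refl y)

theorem relComp_str_ext_str₀ : relComp X.str (𝕋.ext X.str₀) = X.str := by
  apply le_antisymm
  · exact fun 𝔵 y => iSup_le fun 𝔶 => X.ext_str₀_mul_str 𝔵 𝔶 y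
  · intro 𝔵 y
    refine le_trans ?_ (le_relComp 𝔵)
    exact le_mul_of_one_le_left' (𝕋.one_le_ext_refl X.refl 𝔵)

theorem str₀_trans (x y z : X.carrier) : X.str₀ x y * X.str₀ y z ≤ X.str₀ x z :=
  X.str_mul_str₀ (𝕋.e x) y z

theorem relComp_str₀_str₀ : relComp X.str₀ X.str₀ = X.str₀ := by
  funext x y
  exact congrFun (congrFun X.relComp_str₀_str (𝕋.e x)) y

end TCat

variable (𝕋) in
/-- The `𝕋`-relation `T_ξ a · m° · m` on `TX`. -/
def freeStr {X : Type u} (a : 𝕋.F X → X → V) : 𝕋.F (𝕋.F X) → 𝕋.F X → V :=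
  fun 𝔛 𝔵 => ⨆ (𝔜 : 𝕋.F (𝕋.F X)) (_ : 𝕋.m 𝔜 = 𝕋.m 𝔛), 𝕋.ext a 𝔜 𝔵

theorem le_freeStr {X : Type u} (a : 𝕋.F X → X → V) {𝔛 𝔜 : 𝕋.F (𝕋.F X)} (h : 𝕋.m 𝔜 = 𝕋.m 𝔛)
    (𝔵 : 𝕋.F X) : 𝕋.ext a 𝔜 𝔵 ≤ 𝕋.freeStr a 𝔛 𝔵 :=
  le_iSup₂ (f := fun (𝔜 : 𝕋.F (𝕋.F X)) (_ : 𝕋.m 𝔜 = 𝕋.m 𝔛) => 𝕋.ext a 𝔜 𝔵) 𝔜 h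

theorem ext_freeStr_le {X : Type u} (a : 𝕋.F X → X → V) (𝔐 : 𝕋.F (𝕋.F (𝕋.F X)))
    (𝔛 : 𝕋.F (𝕋.F X)) : 𝕋.ext (𝕋.freeStr a) 𝔐 𝔛 ≤
      ⨆ (𝔑 : 𝕋.F (𝕋.F (𝕋.F X))) (_ : 𝕋.map 𝕋.m 𝔑 = 𝕋.map 𝕋.m 𝔐), 𝕋.ext (𝕋.ext a) 𝔑 𝔛 := by
  let r : 𝕋.F X → 𝕋.F X → V := fun 𝔶 𝔵 => ⨆ (𝔜 : 𝕋.F (𝕋.F X)) (_ : 𝕋.m 𝔜 = 𝔶), 𝕋.ext a 𝔜 𝔵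
  have h0 : 𝕋.freeStr a = fun 𝔛 𝔵 => r (𝕋.m 𝔛) 𝔵 := rfl
  rw [h0, ext_precomp]
  have key : (fun p : 𝕋.F X × 𝕋.F X => r p.1 p.2) =
      directImage (fun q : 𝕋.F (𝕋.F X) × 𝕋.F X => (𝕋.m q.1, q.2)) (fun q => 𝕋.ext a q.1 q.2) := by
    funext p
    apply le_antisymm
    · refine iSup₂_le fun 𝔜 h𝔜 => ?_
      exact le_iSup₂ (f := fun (q : 𝕋.F (𝕋.F X) × 𝕋.F X) (_ : (𝕋.m q.1, q.2) = p) =>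
        𝕋.ext a q.1 q.2) (𝔜, p.2) (Prod.ext h𝔜 rfl)
    · refine iSup₂_le ?_
      rintro q rfl
      exact le_iSup₂ (f := fun (𝔜 : 𝕋.F (𝕋.F X)) (_ : 𝕋.m 𝔜 = 𝕋.m q.1) => 𝕋.ext a 𝔜 q.2) q.1 rfl
  refine iSup₂_le ?_
  rintro w ⟨hw, rfl⟩
  rw [key, ξ_map_directImage]
  refine iSup₂_le ?_
  rintro v rfl
  have h1 := 𝕋.le_ext (𝕋.ext a) v
  simp only [map_map] at hw ⊢
  refine h1.trans (le_iSup₂ (f := fun (𝔑 : 𝕋.F (𝕋.F (𝕋.F X)))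
    (_ : 𝕋.map 𝕋.m 𝔑 = 𝕋.map 𝕋.m 𝔐) => 𝕋.ext (𝕋.ext a) 𝔑 (𝕋.map Prod.snd v))
      (𝕋.map Prod.fst v) ?_)
  rw [← hw, map_map]

/-- The `𝕋`-category `TX = (TX, T_ξ a · m° · m)`. -/
@[reducible]
def TCat.free (X : TCat 𝕋) : TCat 𝕋 where
  carrier := 𝕋.F X.carrier
  str := 𝕋.freeStr X.str
  refl 𝔵 := by
    refine le_trans ?_ (le_freeStr X.str (𝔜 := 𝕋.map 𝕋.e 𝔵) ((𝕋.m_map_e 𝔵).trans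
      (𝕋.m_e 𝔵).symm) 𝔵)
    rw [← ext_precomp]
    exact 𝕋.one_le_ext_refl X.refl 𝔵
  trans 𝔐 𝔛 𝔵 := by
    refine (mul_le_mul_left (ext_freeStr_le X.str 𝔐 𝔛) _).trans ?_
    refine qSup_mul_le fun 𝔑 h𝔑 => ?_
    refine mul_qSup_le fun 𝔜 h𝔜 => ?_
    have h1 : 𝕋.ext (𝕋.ext X.str) 𝔑 𝔛 ≤ 𝕋.ext X.str (𝕋.m 𝔑) (𝕋.m 𝔜) := by
      rw [h𝔜]
      exact 𝕋.ext_ext_le _ _ _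
    have h2 : 𝕋.ext X.str (𝕋.m 𝔑) (𝕋.m 𝔜) ≤
        ⨆ (𝔓 : 𝕋.F (𝕋.F (𝕋.F X.carrier))) (_ : 𝕋.m 𝔓 = 𝕋.m 𝔑),
          𝕋.ext (𝕋.ext X.str) 𝔓 𝔜 := by
      rw [← ext_swap]
      refine (𝕋.ext_m_le _ _ _).trans (iSup₂_mono fun 𝔓 _ => ?_)
      rw [← ext_swap (r := 𝕋.ext X.str)]
      refine 𝕋.ext_mono (fun y x => ?_) _ _
      rw [ext_swap]
    refine (mul_le_mul_left (h1.trans h2) _).trans ?_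
    refine qSup_mul_le fun 𝔓 h𝔓 => ?_
    have h3 : 𝕋.ext (𝕋.ext X.str) 𝔓 𝔜 * 𝕋.ext X.str 𝔜 𝔵 ≤
        relComp (𝕋.ext X.str) (𝕋.ext (𝕋.ext X.str)) 𝔓 𝔵 := le_relComp _
    rw [← ext_comp] at h3
    have h4 := h3.trans (𝕋.ext_mono (s := fun 𝔛 x => X.str (𝕋.m 𝔛) x) X.comp_le 𝔓 𝔵)
    rw [ext_precomp (s := X.str) (f := 𝕋.m)] at h4
    refine h4.trans (le_freeStr X.str ?_ 𝔵)
    rw [m_map_m, h𝔓, ← m_map_m, h𝔑, m_map_m]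

/-- The order between functions into a `𝕋`-category, evaluated at a point: `1 ≤ a₀(x, y)`. -/
def TCat.Le (X : TCat 𝕋) (x y : X.carrier) : Prop := 1 ≤ X.str₀ x y

/-- Points are equivalent if they are below each other. -/
def TCat.Equivalent (X : TCat 𝕋) (x y : X.carrier) : Prop := X.Le x y ∧ X.Le y x

theorem TCat.Le.trans {X : TCat 𝕋} {x y z : X.carrier} (h : X.Le x y) (h' : X.Le y z) :
    X.Le x z := by
  have := mul_le_mul' h h'
  rw [one_mul] at this
  exact this.trans (X.str₀_trans x y z)

theorem IsTFunctor.le {X Y : TCat 𝕋} {f : X.carrier → Y.carrier}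
    (hf : 𝕋.IsTFunctor X.str Y.str f) (x y : X.carrier) : X.str₀ x y ≤ Y.str₀ (f x) (f y) := by
  have h := hf (𝕋.e x) y
  rwa [map_e] at h

theorem IsTFunctor.map_le {X Y : TCat 𝕋} {f : X.carrier → Y.carrier}
    (hf : 𝕋.IsTFunctor X.str Y.str f) {x y : X.carrier} (h : X.Le x y) : Y.Le (f x) (f y) :=
  LE.le.trans h (hf.le x y)

theorem IsTFunctor.comp {X Y Z : Type u} {a : 𝕋.F X → X → V} {b : 𝕋.F Y → Y → V}
    {c : 𝕋.F Z → Z → V} {g : Y → Z} {f : X → Y} (hg : 𝕋.IsTFunctor b c g)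
    (hf : 𝕋.IsTFunctor a b f) : 𝕋.IsTFunctor a c (fun x => g (f x)) := fun 𝔵 x => by
  have h := (hf 𝔵 x).trans (hg _ _)
  rwa [map_map] at h

/-! ## Representable `𝕋`-categories and pseudo-homomorphisms -/

/-- `α : TX → X` is left adjoint to `e : X → TX` in the `2`-category of `𝕋`-categories. -/
structure TCat.IsLeftAdjointUnit (X : TCat 𝕋) (α : 𝕋.F X.carrier → X.carrier) : Prop where
  isTFunctor : 𝕋.IsTFunctor X.free.str X.str α
  unit : ∀ 𝔵, X.free.Le 𝔵 (𝕋.e (α 𝔵))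
  counit : ∀ x, X.Le (α (𝕋.e x)) x

/-- `X` is representable if `e : X → TX` has a left adjoint. -/
def TCat.IsRepresentable (X : TCat 𝕋) : Prop :=
  ∃ α : 𝕋.F X.carrier → X.carrier, X.IsLeftAdjointUnit α

namespace TCat.IsLeftAdjointUnit

variable {X : TCat 𝕋} {α : 𝕋.F X.carrier → X.carrier}

theorem one_le_str (hα : X.IsLeftAdjointUnit α) (𝔵 : 𝕋.F X.carrier) : 1 ≤ X.str 𝔵 (α 𝔵) := by
  refine LE.le.trans (hα.unit 𝔵) (iSup₂_le fun 𝔜 h𝔜 => ?_)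
  have h := X.trans 𝔜 (𝕋.e (α 𝔵)) (α 𝔵)
  rw [h𝔜.trans (𝕋.m_e 𝔵)] at h
  exact (le_mul_of_one_le_right' (X.refl _)).trans h

theorem str_m_le (hα : X.IsLeftAdjointUnit α) (𝔛 : 𝕋.F (𝕋.F X.carrier)) (x : X.carrier) :
    X.str (𝕋.m 𝔛) x ≤ X.str (𝕋.map α 𝔛) x := by
  have h1 : X.str (𝕋.m 𝔛) x ≤ X.str (𝕋.map α 𝔛) (α (𝕋.e x)) :=
    ((𝕋.le_ext_e X.str (𝕋.m 𝔛) x).trans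
      (le_freeStr X.str (𝔛 := 𝔛) (𝕋.m_e _) (𝕋.e x))).trans (hα.isTFunctor 𝔛 (𝕋.e x))
  have h2 := X.str_mul_str₀ (𝕋.map α 𝔛) (α (𝕋.e x)) x
  exact (h1.trans (le_mul_of_one_le_right' (hα.counit x))).trans h2

/-- A representable structure has the form `a = a₀ · α`. -/
theorem str_eq (hα : X.IsLeftAdjointUnit α) (𝔵 : 𝕋.F X.carrier) (x : X.carrier) :
    X.str 𝔵 x = X.str₀ (α 𝔵) x := by
  apply le_antisymm
  · have h := hα.str_m_le (𝕋.e 𝔵) x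
    rwa [m_e, map_e] at h
  · exact (le_mul_of_one_le_left' (hα.one_le_str 𝔵)).trans (X.str_mul_str₀ 𝔵 (α 𝔵) x)

/-- Representable `𝕋`-categories are core-compact. -/
theorem le_comp (hα : X.IsLeftAdjointUnit α) (𝔛 : 𝕋.F (𝕋.F X.carrier)) (x : X.carrier) :
    X.str (𝕋.m 𝔛) x ≤ relComp X.str (𝕋.ext X.str) 𝔛 x := by
  refine ((hα.str_m_le 𝔛 x).trans (le_mul_of_one_le_left' ?_)).trans (le_relComp (𝕋.map α 𝔛))
  have h := 𝕋.le_ext X.str (𝕋.map (fun 𝔵 => (𝔵, α 𝔵)) 𝔛)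
  simp only [map_map, map_id] at h
  refine le_trans ?_ h
  rw [← 𝕋.ξ_map_one 𝔛]
  exact 𝕋.ξ_map_mono (fun 𝔵 => hα.one_le_str 𝔵) 𝔛

theorem le_of_isLeftAdjointUnit (hα : X.IsLeftAdjointUnit α) {β : 𝕋.F X.carrier → X.carrier}
    (hβ : X.IsLeftAdjointUnit β) (𝔵 : 𝕋.F X.carrier) : X.Le (α 𝔵) (β 𝔵) := by
  unfold TCat.Le
  rw [← hα.str_eq]
  exact hβ.one_le_str 𝔵

end TCat.IsLeftAdjointUnit

/-- `f` is a pseudo-homomorphism: a `𝕋`-functor with `β · Tf ≃ f · α` for the left adjoints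
`α`, `β` of the units (which are unique up to equivalence). -/
structure IsPseudoHom (X Y : TCat 𝕋) (f : X.carrier → Y.carrier) : Prop where
  isTFunctor : 𝕋.IsTFunctor X.str Y.str f
  equivalent : ∀ α β, X.IsLeftAdjointUnit α → Y.IsLeftAdjointUnit β →
    ∀ 𝔵, Y.Equivalent (β (𝕋.map f 𝔵)) (f (α 𝔵))

/-- It suffices to check the condition for one choice of left adjoints. -/
theorem IsPseudoHom.of_eq {X Y : TCat 𝕋} {f : X.carrier → Y.carrier}
    (hf : 𝕋.IsTFunctor X.str Y.str f) {α : 𝕋.F X.carrier → X.carrier}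
    {β : 𝕋.F Y.carrier → Y.carrier} (hα : X.IsLeftAdjointUnit α) (hβ : Y.IsLeftAdjointUnit β)
    (h : ∀ 𝔵, Y.Equivalent (β (𝕋.map f 𝔵)) (f (α 𝔵))) : IsPseudoHom X Y f where
  isTFunctor := hf
  equivalent _ _ hα' hβ' 𝔵 :=
    ⟨((hβ'.le_of_isLeftAdjointUnit hβ _).trans (h 𝔵).1).trans
      (hf.map_le (hα.le_of_isLeftAdjointUnit hα' 𝔵)),
    (hf.map_le (hα'.le_of_isLeftAdjointUnit hα 𝔵)).trans
      ((h 𝔵).2.trans (hβ.le_of_isLeftAdjointUnit hβ' _))⟩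

theorem IsPseudoHom.id (X : TCat 𝕋) : IsPseudoHom X X (fun x => x) where
  isTFunctor 𝔵 x := by rw [map_id]
  equivalent α β hα hβ 𝔵 := by
    rw [map_id]
    exact ⟨hβ.le_of_isLeftAdjointUnit hα 𝔵, hα.le_of_isLeftAdjointUnit hβ 𝔵⟩

theorem IsPseudoHom.comp {X Y Z : TCat 𝕋} {g : Y.carrier → Z.carrier} {f : X.carrier → Y.carrier}
    (hY : Y.IsRepresentable) (hg : IsPseudoHom Y Z g) (hf : IsPseudoHom X Y f) :
    IsPseudoHom X Z (fun x => g (f x)) where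
  isTFunctor := hg.isTFunctor.comp hf.isTFunctor
  equivalent α γ hα hγ 𝔵 := by
    obtain ⟨β, hβ⟩ := hY
    have h1 := hg.equivalent β γ hβ hγ (𝕋.map f 𝔵)
    have h2 := hf.equivalent α β hα hβ 𝔵
    rw [map_map] at h1
    exact ⟨h1.1.trans (hg.isTFunctor.map_le h2.1), (hg.isTFunctor.map_le h2.2).trans h1.2⟩

variable (𝕋) in
/-- Objects of the category `Repr(𝕋)`: representable `𝕋`-categories. -/
structure Repr extends TCat 𝕋 where
  isRepresentable : toTCat.IsRepresentable

/-- Morphisms of `Repr(𝕋)`: pseudo-homomorphisms. -/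
@[ext]
structure Repr.Hom (X Y : Repr 𝕋) where
  toFun : X.carrier → Y.carrier
  isPseudoHom : IsPseudoHom X.toTCat Y.toTCat toFun

instance : Category (Repr 𝕋) where
  Hom := Repr.Hom
  id X := ⟨fun x => x, IsPseudoHom.id X.toTCat⟩
  comp {_ Y _} f g := ⟨fun x => g.toFun (f.toFun x), g.isPseudoHom.comp Y.isRepresentable
    f.isPseudoHom⟩

/-! ## The category `ReprDist(𝕋)` -/

/-- `ψ` is a `V`-distributor `X₀ ⇸ Y₀` with `ψ · a = b · T_ξ ψ`. -/
structure IsReprDist (X Y : TCat 𝕋) (ψ : X.carrier → Y.carrier → V) : Prop where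
  isVDistributor : IsVDistributor X.str₀ Y.str₀ ψ
  comm : relComp ψ X.str = relComp Y.str (𝕋.ext ψ)

theorem IsReprDist.id (X : TCat 𝕋) : IsReprDist X X X.str₀ where
  isVDistributor := ⟨X.relComp_str₀_str₀.le, X.relComp_str₀_str₀.le⟩
  comm := X.relComp_str₀_str.trans X.relComp_str_ext_str₀.symm

theorem IsReprDist.relComp_str₀ {X Y : TCat 𝕋} {ψ : X.carrier → Y.carrier → V}
    (h : IsReprDist X Y ψ) : relComp ψ X.str₀ = ψ :=
  le_antisymm h.isVDistributor.1 fun x _ =>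
    (le_mul_of_one_le_left' (X.refl x)).trans (le_relComp (s := ψ) (r := X.str₀) x)

theorem IsReprDist.str₀_relComp {X Y : TCat 𝕋} {ψ : X.carrier → Y.carrier → V}
    (h : IsReprDist X Y ψ) : relComp Y.str₀ ψ = ψ :=
  le_antisymm h.isVDistributor.2 fun _ y =>
    (le_mul_of_one_le_right' (Y.refl y)).trans (le_relComp (s := Y.str₀) (r := ψ) y)

theorem IsReprDist.comp {X Y Z : TCat 𝕋} {χ : Y.carrier → Z.carrier → V}
    {ψ : X.carrier → Y.carrier → V} (hχ : IsReprDist Y Z χ) (hψ : IsReprDist X Y ψ) :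
    IsReprDist X Z (relComp χ ψ) where
  isVDistributor := by
    constructor
    · rw [← relComp_assoc, hψ.relComp_str₀]
    · rw [relComp_assoc, hχ.str₀_relComp]
  comm := by
    rw [ext_comp, ← relComp_assoc, hψ.comm, relComp_assoc, hχ.comm, relComp_assoc]

variable (𝕋) in
/-- Objects of the category `ReprDist(𝕋)`: representable `𝕋`-categories. -/
structure ReprDist where
  of : Repr 𝕋

/-- Morphisms of `ReprDist(𝕋)`. -/
@[ext]
structure ReprDist.Hom (X Y : ReprDist 𝕋) where
  rel : X.of.carrier → Y.of.carrier → V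
  isReprDist : IsReprDist X.of.toTCat Y.of.toTCat rel

instance : Category (ReprDist 𝕋) where
  Hom := ReprDist.Hom
  id X := ⟨X.of.str₀, IsReprDist.id X.of.toTCat⟩
  comp ψ χ := ⟨relComp χ.rel ψ.rel, χ.isReprDist.comp ψ.isReprDist⟩
  id_comp ψ := ReprDist.Hom.ext ψ.isReprDist.relComp_str₀
  comp_id ψ := ReprDist.Hom.ext ψ.isReprDist.str₀_relComp
  assoc ψ χ ω := ReprDist.Hom.ext (relComp_assoc ω.rel χ.rel ψ.rel)

/-! ## Kleisli convolution -/

variable (𝕋) in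
/-- The Kleisli convolution `β ∘ α = β · T_ξ α · m°` of `𝕋`-relations. -/
def kconv {X Y Z : Type u} (β : 𝕋.F Y → Z → V) (α : 𝕋.F X → Y → V) : 𝕋.F X → Z → V :=
  fun 𝔵 z => ⨆ (𝔛 : 𝕋.F (𝕋.F X)) (_ : 𝕋.m 𝔛 = 𝔵), relComp β (𝕋.ext α) 𝔛 z

/-- The `𝕋`-relation `f_⊛ = b · Tf`. -/
def lowerStar {X : Type u} (Y : TCat 𝕋) (f : X → Y.carrier) : 𝕋.F X → Y.carrier → V :=
  fun 𝔵 y => Y.str (𝕋.map f 𝔵) y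

/-- The `𝕋`-relation `f^⊛ = f° · b`. -/
def upperStar {X : Type u} (Y : TCat 𝕋) (f : X → Y.carrier) : 𝕋.F Y.carrier → X → V :=
  fun 𝔶 x => Y.str 𝔶 (f x)

variable (𝕋) in
/-- The Kleisli convolution `ψ ∘ φ` of a `𝕋`-relation `ψ` from `X` to `Y` with a `V`-valued function
`φ` on `X`, the latter being considered as a `𝕋`-relation from `1` to `X`. -/
def act {X Y : Type u} (ψ : 𝕋.F X → Y → V) (φ : X → V) : Y → V :=
  fun y => 𝕋.kconv ψ (fun (_ : 𝕋.F PUnit.{u + 1}) x => φ x) (𝕋.e PUnit.unit) y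

/-! ## The Vietoris construction -/

variable (𝕋) in
/-- The `𝕋`-relation `hom_ξ` on `V`. -/
def homξ : 𝕋.F V → V → V := fun 𝔳 v => ihom (𝕋.ξ 𝔳) v

/-- The underlying set of the exponential `V^X`: the `𝕋`-functors from `X` to `(V, hom_ξ)`. (This is
used for theories with `T1 = 1`, where `G ⊗ X = X` for the generator `G = (1, e°)`.) -/
abbrev Pow (X : TCat 𝕋) : Type u := {φ : X.carrier → V // 𝕋.IsTFunctor X.str 𝕋.homξ φ}

/-- The evaluation, as a `V`-relation. -/
def ev (X : TCat 𝕋) : Pow X → X.carrier → V := fun φ x => φ.1 x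

/-- The `𝕋`-graph structure of the exponential `V^X`. -/
def powStr (X : TCat 𝕋) : 𝕋.F (Pow X) → Pow X → V := fun 𝔭 h =>
  ⨅ (𝔮 : 𝕋.F (Pow X × X.carrier)) (x : X.carrier) (_ : 𝕋.map Prod.fst 𝔮 = 𝔭),
    ihom (X.str (𝕋.map Prod.snd 𝔮) x) (𝕋.homξ (𝕋.map (fun p => ev X p.1 p.2) 𝔮) (h.1 x))

/-- The `V`-relation `μ = a · T_ξ ev`. -/
def mu (X : TCat 𝕋) : 𝕋.F (Pow X) → X.carrier → V := relComp X.str (𝕋.ext (ev X))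

/-- The structure of `VX`, the dual of `V^X`. -/
def vStr (X : TCat 𝕋) : 𝕋.F (Pow X) → Pow X → V := fun 𝔭 φ => ⨅ x, ihom (φ.1 x) (mu X 𝔭 x)

theorem Pow.ext {X : TCat 𝕋} {φ ψ : Pow X} (h : ∀ x, φ.1 x = ψ.1 x) : φ = ψ :=
  Subtype.ext (funext h)

theorem isTFunctor_homξ_iff {X : TCat 𝕋} {φ : X.carrier → V} :
    𝕋.IsTFunctor X.str 𝕋.homξ φ ↔ ∀ 𝔵 x, X.str 𝔵 x * 𝕋.ξ (𝕋.map φ 𝔵) ≤ φ x :=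
  forall₂_congr fun _ _ => le_ihom

theorem Pow.mul_le {X : TCat 𝕋} (φ : Pow X) (𝔵 : 𝕋.F X.carrier) (x : X.carrier) :
    X.str 𝔵 x * 𝕋.ξ (𝕋.map φ.1 𝔵) ≤ φ.1 x := isTFunctor_homξ_iff.1 φ.2 𝔵 x

theorem Pow.str₀_mul_le {X : TCat 𝕋} (φ : Pow X) (x y : X.carrier) :
    X.str₀ x y * φ.1 x ≤ φ.1 y := by
  have h := φ.mul_le (𝕋.e x) y
  rwa [ξ_map_e] at h

theorem le_vStr {X : TCat 𝕋} {𝔭 : 𝕋.F (Pow X)} {φ : Pow X} {v : V} :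
    v ≤ vStr X 𝔭 φ ↔ ∀ x, v * φ.1 x ≤ mu X 𝔭 x :=
  le_iInf_iff.trans (forall_congr' fun _ => le_ihom)

theorem vStr_mul_le (X : TCat 𝕋) (𝔭 : 𝕋.F (Pow X)) (φ : Pow X) (x : X.carrier) :
    vStr X 𝔭 φ * φ.1 x ≤ mu X 𝔭 x := le_vStr.1 le_rfl x

theorem relComp_mu_le (X : TCat 𝕋) (𝔓 : 𝕋.F (𝕋.F (Pow X))) (x : X.carrier) :
    relComp X.str (𝕋.ext (mu X)) 𝔓 x ≤ mu X (𝕋.m 𝔓) x :=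
  𝕋.relComp_ext_ext_le X.comp_le (ev X) 𝔓 x

theorem mu_relComp_le (X : TCat 𝕋) (𝔓 : 𝕋.F (𝕋.F (Pow X))) (x : X.carrier) :
    relComp (mu X) (𝕋.ext (vStr X)) 𝔓 x ≤ mu X (𝕋.m 𝔓) x := by
  refine le_trans ?_ (relComp_mu_le X 𝔓 x)
  have h1 : relComp (ev X) (vStr X) ≤ mu X :=
    fun 𝔭 x => iSup_le fun φ => vStr_mul_le X 𝔭 φ x
  have h2 : relComp (mu X) (𝕋.ext (vStr X)) =
      relComp X.str (𝕋.ext (relComp (ev X) (vStr X))) := by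
    rw [ext_comp, relComp_assoc]
    rfl
  rw [h2]
  exact relComp_mono le_rfl (𝕋.ext_mono h1) 𝔓 x

/-- The `𝕋`-category `VX`. -/
@[reducible]
def TCat.vietoris (X : TCat 𝕋) : TCat 𝕋 where
  carrier := Pow X
  str := vStr X
  refl φ := le_vStr.2 fun x => by
    rw [one_mul]
    refine le_trans ?_ (le_relComp (𝕋.e x))
    exact (𝕋.le_ext_e (ev X) φ x).trans (le_mul_of_one_le_right' (X.refl x))
  trans 𝔓 𝔭 φ := le_vStr.2 fun x => by
    rw [mul_assoc]
    exact (mul_le_mul_right (vStr_mul_le X 𝔭 φ x) _).trans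
      ((le_relComp 𝔭).trans (mu_relComp_le X 𝔓 x))

theorem powStr_eq (X : TCat 𝕋) (𝔭 : 𝕋.F (Pow X)) (h : Pow X) :
    powStr X 𝔭 h = ⨅ x, ihom (mu X 𝔭 x) (h.1 x) := by
  apply le_antisymm
  · refine le_iInf fun x => le_ihom.2 ?_
    rw [mu, relComp, mul_comm]
    refine le_ihom.1 (iSup_le fun 𝔵 => le_ihom.2 ?_)
    rw [mul_assoc]
    refine qSup_mul_le ?_
    rintro 𝔮 ⟨h1, rfl⟩
    have h2 : powStr X 𝔭 h ≤ _ := (iInf_le _ 𝔮).trans ((iInf_le _ x).trans (iInf_le _ h1))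
    have h3 := le_ihom.1 (le_ihom.1 h2)
    refine le_trans (le_of_eq ?_) h3
    rw [mul_comm, mul_comm (X.str _ _)]
  · refine le_iInf fun 𝔮 => le_iInf fun x => le_iInf fun h1 => le_ihom.2 (le_ihom.2 ?_)
    subst h1
    have h2 : (⨅ x, ihom (mu X (𝕋.map Prod.fst 𝔮) x) (h.1 x)) * mu X (𝕋.map Prod.fst 𝔮) x ≤ h.1 x :=
      le_ihom.1 (iInf_le _ x)
    refine le_trans ?_ h2
    rw [mul_assoc]
    refine mul_le_mul_right ?_ _
    rw [mul_comm]
    exact (mul_le_mul_left (𝕋.le_ext (ev X) 𝔮) _).trans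
      (le_relComp (s := X.str) (r := 𝕋.ext (ev X)) (𝕋.map Prod.snd 𝔮))

theorem mu_map {A : Type u} (X : TCat 𝕋) (g : A → Pow X) (𝔞 : 𝕋.F A) :
    mu X (𝕋.map g 𝔞) = relComp X.str (𝕋.ext (fun z => (g z).1)) 𝔞 := by
  funext x
  exact iSup_congr fun 𝔵 => by rw [← ext_precomp]; rfl

theorem TCat.Equivalent.of_eq {X : TCat 𝕋} {x y : X.carrier} (h : x = y) : X.Equivalent x y := by
  subst h
  exact ⟨X.refl x, X.refl x⟩

theorem IsPseudoHom.lowerStar_eq {X Y : TCat 𝕋} {f : X.carrier → Y.carrier}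
    (hf : IsPseudoHom X Y f) {α : 𝕋.F X.carrier → X.carrier}
    (hα : X.IsLeftAdjointUnit α) (hY : Y.IsRepresentable) (𝔵 : 𝕋.F X.carrier) (y : Y.carrier) :
    lowerStar Y f 𝔵 y = Y.str₀ (f (α 𝔵)) y := by
  obtain ⟨β, hβ⟩ := hY
  have h := hf.equivalent α β hα hβ 𝔵
  rw [lowerStar, hβ.str_eq]
  exact le_antisymm ((le_mul_of_one_le_left' h.2).trans (Y.str₀_trans _ _ y))
    ((le_mul_of_one_le_left' h.1).trans (Y.str₀_trans _ _ y))

theorem IsPseudoHom.relComp_str {X Y : TCat 𝕋} {f : X.carrier → Y.carrier}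
    (hf : IsPseudoHom X Y f) (hX : X.IsRepresentable)
    (hY : Y.IsRepresentable) :
    relComp (fun x y => Y.str₀ (f x) y) X.str = lowerStar Y f := by
  obtain ⟨α, hα⟩ := hX
  funext 𝔵 y
  apply le_antisymm
  · refine iSup_le fun x => ?_
    exact (mul_le_mul_left (hf.isTFunctor 𝔵 x) _).trans (Y.str_mul_str₀ _ _ _)
  · rw [hf.lowerStar_eq hα hY]
    exact (le_mul_of_one_le_left' (hα.one_le_str 𝔵)).trans
      (le_relComp (s := fun x y => Y.str₀ (f x) y) (r := X.str) (α 𝔵))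

theorem Repr.hom_ext {X Y : Repr 𝕋} {f g : X ⟶ Y} (h : ∀ x, f.toFun x = g.toFun x) : f = g :=
  Repr.Hom.ext (funext h)

section

variable [Subsingleton (𝕋.F PUnit.{u + 1})]

theorem act_apply {X Y : Type u} (ψ : 𝕋.F X → Y → V) (φ : X → V) (y : Y) :
    𝕋.act ψ φ y = ⨆ 𝔵, 𝕋.ξ (𝕋.map φ 𝔵) * ψ 𝔵 y := by
  have h : ∀ 𝔛 : 𝕋.F (𝕋.F PUnit.{u + 1}),
      relComp ψ (𝕋.ext (fun (_ : 𝕋.F PUnit.{u + 1}) x => φ x)) 𝔛 y =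
        ⨆ 𝔵, 𝕋.ξ (𝕋.map φ 𝔵) * ψ 𝔵 y := by
    intro 𝔛
    refine iSup_congr fun 𝔵 => ?_
    have h1 := 𝕋.ext_precomp (fun (_ : PUnit.{u + 1}) x => φ x)
      (fun _ : 𝕋.F PUnit.{u + 1} => PUnit.unit) 𝔛 𝔵
    rw [h1, Subsingleton.elim (𝕋.map _ 𝔛) (𝕋.e PUnit.unit), ext_e]
  simp only [act, kconv, h]
  exact le_antisymm (iSup₂_le fun _ _ => le_rfl)
    (le_iSup₂_of_le (𝕋.e (𝕋.e PUnit.unit)) (𝕋.m_e _) le_rfl)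

theorem mu_e (X : TCat 𝕋) (φ : Pow X) (x : X.carrier) : mu X (𝕋.e φ) x = φ.1 x := by
  apply le_antisymm
  · refine iSup_le fun 𝔵 => ?_
    rw [ext_e, mul_comm]
    exact φ.mul_le 𝔵 x
  · refine le_trans ?_ (le_relComp (𝕋.e x))
    exact (𝕋.le_ext_e (ev X) φ x).trans (le_mul_of_one_le_right' (X.refl x))

theorem isTFunctor_relComp {A X : Type u} {Y : TCat 𝕋} {ψ : 𝕋.F X → Y.carrier → V}
    (h : ∀ 𝔛 y, relComp Y.str (𝕋.ext ψ) 𝔛 y ≤ ψ (𝕋.m 𝔛) y) (s : A → X → V) (𝔞 : 𝕋.F A) :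
    𝕋.IsTFunctor Y.str 𝕋.homξ (relComp ψ (𝕋.ext s) 𝔞) := by
  rw [isTFunctor_homξ_iff]
  intro 𝔶 y
  have h1 := 𝕋.relComp_ext_ext_le h s (𝕋.e 𝔞) y
  rw [m_e] at h1
  refine le_trans ?_ h1
  refine le_trans ?_ (le_relComp 𝔶)
  rw [ext_e, mul_comm]

/-- The function `T(V^X) → V^X` induced by `μ`. -/
def mate (X : TCat 𝕋) (𝔭 : 𝕋.F (Pow X)) : Pow X :=
  ⟨mu X 𝔭, isTFunctor_relComp X.comp_le (ev X) 𝔭⟩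

/-- The exponential `V^X` is dualisable: its structure has the form `a = a₀ · α`. -/
theorem powStr_dualisable (X : TCat 𝕋) (𝔭 : 𝕋.F (Pow X)) (h : Pow X) :
    powStr X 𝔭 h = 𝕋.under (powStr X) (mate X 𝔭) h := by
  simp only [under, powStr_eq, mu_e]
  rfl

/-- The structure of `VX` is the dual `a₀° · α` of the structure of `V^X`. -/
theorem vStr_eq_dual (X : TCat 𝕋) (𝔭 : 𝕋.F (Pow X)) (h : Pow X) :
    vStr X 𝔭 h = 𝕋.under (powStr X) h (mate X 𝔭) := by
  simp only [under, powStr_eq, mu_e]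
  rfl

/-- The Yoneda map `X → VX`. -/
def yoneda (X : TCat 𝕋) (x : X.carrier) : Pow X :=
  ⟨X.str₀ x, isTFunctor_homξ_iff.2 fun 𝔵 y => by
    rw [← ext_e, mul_comm]
    exact X.ext_str₀_mul_str (𝕋.e x) 𝔵 y⟩

theorem vStr_yoneda (X : TCat 𝕋) (𝔭 : 𝕋.F (Pow X)) (x : X.carrier) :
    vStr X 𝔭 (yoneda X x) = mu X 𝔭 x := by
  apply le_antisymm
  · exact (le_mul_of_one_le_right' (X.refl x)).trans (vStr_mul_le X 𝔭 (yoneda X x) x)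
  · refine le_vStr.2 fun y => ?_
    have h : relComp X.str₀ (mu X) = mu X := by
      rw [mu, relComp_assoc, X.relComp_str₀_str]
    have h1 := le_relComp (s := X.str₀) (r := mu X) (x := 𝔭) (z := y) x
    rwa [h] at h1

theorem str₀_yoneda (X : TCat 𝕋) (φ : Pow X) (x : X.carrier) :
    X.vietoris.str₀ φ (yoneda X x) = φ.1 x := (vStr_yoneda X _ x).trans (mu_e X φ x)

/-- `Vf = f_⊛ ∘ -`. -/
def vMap (X Y : TCat 𝕋) (f : X.carrier → Y.carrier) (φ : Pow X) : Pow Y :=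
  ⟨𝕋.act (lowerStar Y f) φ.1, by
    have h : 𝕋.act (lowerStar Y f) φ.1 = relComp (lowerStar Y f) (𝕋.ext (ev X)) (𝕋.e φ) := by
      funext y
      rw [act_apply]
      exact iSup_congr fun 𝔵 => by rw [ext_e]; rfl
    rw [h]
    refine isTFunctor_relComp (fun 𝔛 y => ?_) _ _
    have h1 : 𝕋.ext (lowerStar Y f) = fun 𝔛 𝔶 => 𝕋.ext Y.str (𝕋.map (𝕋.map f) 𝔛) 𝔶 := by
      funext 𝔛 𝔶
      exact 𝕋.ext_precomp Y.str (𝕋.map f) 𝔛 𝔶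
    rw [h1]
    refine (Y.comp_le (𝕋.map (𝕋.map f) 𝔛) y).trans_eq ?_
    rw [← map_m]
    rfl⟩

theorem act_upperStar (X : TCat 𝕋) (Φ : Pow X.vietoris) (x : X.carrier) :
    𝕋.act (upperStar X.vietoris (yoneda X)) Φ.1 x = Φ.1 (yoneda X x) := by
  rw [act_apply]
  apply le_antisymm
  · refine iSup_le fun 𝔭 => ?_
    rw [mul_comm]
    exact Φ.mul_le 𝔭 (yoneda X x)
  · refine le_trans ?_ (le_iSup _ (𝕋.e (yoneda X x)))
    rw [ξ_map_e]
    exact le_mul_of_one_le_right' (X.vietoris.refl (yoneda X x))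

theorem yoneda_isTFunctor (X : TCat 𝕋) : 𝕋.IsTFunctor X.str X.vietoris.str (yoneda X) := by
  intro 𝔵 x
  refine le_of_eq ?_
  change _ = vStr X _ _
  rw [vStr_yoneda, mu_map]
  exact (congrFun (congrFun X.relComp_str_ext_str₀ 𝔵) x).symm

/-- The multiplication `y^⊛ ∘ -` at `X`. -/
def vMult (X : TCat 𝕋) (Φ : Pow X.vietoris) : Pow X :=
  ⟨𝕋.act (upperStar X.vietoris (yoneda X)) Φ.1, by
    rw [funext (act_upperStar X Φ)]
    exact IsTFunctor.comp Φ.2 (yoneda_isTFunctor X)⟩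

theorem vMult_apply (X : TCat 𝕋) (Φ : Pow X.vietoris) (x : X.carrier) :
    (vMult X Φ).1 x = Φ.1 (yoneda X x) := act_upperStar X Φ x

theorem vMult_apply' (X : TCat 𝕋) (Φ : Pow X.vietoris) (x : X.carrier) :
    (vMult X Φ).1 x = ⨆ φ : Pow X, Φ.1 φ * φ.1 x := by
  rw [vMult_apply]
  apply le_antisymm
  · exact (le_mul_of_one_le_right' (X.refl x)).trans
      (le_iSup (fun φ : Pow X => Φ.1 φ * φ.1 x) (yoneda X x))
  · refine iSup_le fun φ => ?_
    rw [mul_comm, ← str₀_yoneda X φ x]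
    exact Φ.str₀_mul_le φ (yoneda X x)

theorem mate_isLeftAdjointUnit {X : TCat 𝕋} (hX : X.IsRepresentable) :
    X.vietoris.IsLeftAdjointUnit (mate X) where
  isTFunctor 𝔓 𝔭 := by
    obtain ⟨α, hα⟩ := hX
    refine iSup₂_le fun 𝔔 h𝔔 => ?_
    refine le_vStr.2 fun x => ?_
    have h1 : 𝕋.ext (vStr X) 𝔔 𝔭 * mu X 𝔭 x ≤ mu X (𝕋.m 𝔓) x :=
      ((le_relComp 𝔭).trans (mu_relComp_le X 𝔔 x)).trans_eq (by rw [← h𝔔])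
    refine h1.trans ?_
    rw [mu_map]
    exact 𝕋.le_relComp_ext_ext hα.le_comp (ev X) 𝔓 x
  unit 𝔭 := by
    refine le_trans ?_ (le_freeStr X.vietoris.str (𝔜 := 𝕋.e 𝔭) rfl (𝕋.e (mate X 𝔭)))
    refine le_trans ?_ (𝕋.le_ext_e X.vietoris.str 𝔭 (mate X 𝔭))
    exact le_vStr.2 fun x => (one_mul _).le
  counit φ := by
    refine le_vStr.2 fun x => ?_
    rw [mu_e, one_mul]
    exact (mu_e X φ x).ge

theorem vietoris_isRepresentable {X : TCat 𝕋} (hX : X.IsRepresentable) :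
    X.vietoris.IsRepresentable := ⟨mate X, mate_isLeftAdjointUnit hX⟩

theorem yoneda_isPseudoHom {X : TCat 𝕋} (hX : X.IsRepresentable) :
    IsPseudoHom X X.vietoris (yoneda X) := by
  obtain ⟨α, hα⟩ := hX
  refine .of_eq (yoneda_isTFunctor X) hα (mate_isLeftAdjointUnit ⟨α, hα⟩) fun 𝔵 => .of_eq ?_
  refine Pow.ext fun x => ?_
  change mu X (𝕋.map (yoneda X) 𝔵) x = X.str₀ (α 𝔵) x
  rw [mu_map, ← hα.str_eq]
  exact congrFun (congrFun X.relComp_str_ext_str₀ 𝔵) x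

theorem vMult_isPseudoHom {X : TCat 𝕋} (hX : X.IsRepresentable) :
    IsPseudoHom X.vietoris.vietoris X.vietoris (vMult X) := by
  have hmu : ∀ (𝔓 : 𝕋.F (Pow X.vietoris)) (x : X.carrier),
      mu X (𝕋.map (vMult X) 𝔓) x = mu X.vietoris 𝔓 (yoneda X x) := by
    intro 𝔓 x
    have h1 : (fun Φ => (vMult X Φ).1) = relComp (ev X) (ev X.vietoris) := by
      funext Φ x
      exact vMult_apply' X Φ x
    rw [mu_map, h1, ext_comp, relComp_assoc]
    refine iSup_congr fun 𝔭 => ?_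
    exact congrArg _ (vStr_yoneda X 𝔭 x).symm
  refine .of_eq (fun 𝔓 Φ => ?_) (mate_isLeftAdjointUnit (vietoris_isRepresentable hX))
    (mate_isLeftAdjointUnit hX) fun 𝔓 => .of_eq ?_
  · refine le_vStr.2 fun x => ?_
    rw [hmu, vMult_apply]
    exact vStr_mul_le X.vietoris 𝔓 Φ (yoneda X x)
  · refine Pow.ext fun x => ?_
    rw [vMult_apply]
    exact hmu 𝔓 x

section PseudoHom

variable {X Y : TCat 𝕋} {f : X.carrier → Y.carrier}

theorem IsPseudoHom.vMap_apply (hf : IsPseudoHom X Y f) (hX : X.IsRepresentable)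
    (hY : Y.IsRepresentable) (φ : Pow X) (y : Y.carrier) :
    (vMap X Y f φ).1 y = ⨆ x, φ.1 x * Y.str₀ (f x) y := by
  obtain ⟨α, hα⟩ := hX
  refine (act_apply _ _ _).trans (le_antisymm ?_ ?_)
  · refine iSup_le fun 𝔵 => ?_
    rw [hf.lowerStar_eq hα hY]
    refine le_trans (mul_le_mul_left ?_ _)
      (le_iSup (fun x => φ.1 x * Y.str₀ (f x) y) (α 𝔵))
    exact (le_mul_of_one_le_left' (hα.one_le_str 𝔵)).trans (φ.mul_le 𝔵 (α 𝔵))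
  · refine iSup_le fun x => ?_
    refine le_trans ?_ (le_iSup _ (𝕋.e x))
    rw [ξ_map_e, lowerStar, map_e]
    rfl

theorem IsPseudoHom.mu_map_vMap (hf : IsPseudoHom X Y f) (hX : X.IsRepresentable)
    (hY : Y.IsRepresentable) (𝔭 : 𝕋.F (Pow X)) :
    mu Y (𝕋.map (vMap X Y f) 𝔭) = (vMap X Y f (mate X 𝔭)).1 := by
  have h1 : (fun φ => (vMap X Y f φ).1) = relComp (fun x y => Y.str₀ (f x) y) (ev X) := by
    funext φ y
    exact hf.vMap_apply hX hY φ y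
  have h2 : relComp Y.str (𝕋.ext (fun x y => Y.str₀ (f x) y)) = lowerStar Y f := by
    funext 𝔵 y
    refine Eq.trans ?_ (congrFun (congrFun Y.relComp_str_ext_str₀ (𝕋.map f 𝔵)) y)
    exact iSup_congr fun 𝔶 => by rw [ext_precomp]
  rw [mu_map, h1, ext_comp, relComp_assoc, h2, ← hf.relComp_str hX hY, ← relComp_assoc]
  funext y
  exact (hf.vMap_apply hX hY (mate X 𝔭) y).symm

theorem IsPseudoHom.vMap (hf : IsPseudoHom X Y f) (hX : X.IsRepresentable)
    (hY : Y.IsRepresentable) : IsPseudoHom X.vietoris Y.vietoris (vMap X Y f) := by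
  refine .of_eq (fun 𝔭 φ => ?_) (mate_isLeftAdjointUnit hX) (mate_isLeftAdjointUnit hY)
    fun 𝔭 => .of_eq (Subtype.ext (hf.mu_map_vMap hX hY 𝔭))
  refine le_vStr.2 fun y => ?_
  rw [hf.mu_map_vMap hX hY, hf.vMap_apply hX hY, hf.vMap_apply hX hY, Quantale.mul_iSup_distrib]
  refine iSup_mono fun x => ?_
  rw [← mul_assoc]
  exact mul_le_mul_left (vStr_mul_le X 𝔭 φ x) _

end PseudoHom

/-! ## The Vietoris monad on `Repr(𝕋)` -/

theorem Repr.vMap_apply {X Y : Repr 𝕋} (f : X ⟶ Y) (φ : Pow X.toTCat) (y : Y.carrier) :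
    (vMap X.toTCat Y.toTCat f.toFun φ).1 y = ⨆ x, φ.1 x * Y.str₀ (f.toFun x) y :=
  f.isPseudoHom.vMap_apply X.isRepresentable Y.isRepresentable φ y

/-- `V` as an endofunctor of `Repr(𝕋)`. -/
@[reducible]
def vFunctor : Repr 𝕋 ⥤ Repr 𝕋 where
  obj X := ⟨X.vietoris, vietoris_isRepresentable X.isRepresentable⟩
  map {X Y} f := ⟨vMap X.toTCat Y.toTCat f.toFun,
    f.isPseudoHom.vMap X.isRepresentable Y.isRepresentable⟩
  map_id X := Repr.hom_ext fun φ => Pow.ext fun y => by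
    refine (Repr.vMap_apply (𝟙 X) φ y).trans (le_antisymm ?_ ?_)
    · refine iSup_le fun x => ?_
      rw [mul_comm]
      exact Pow.str₀_mul_le φ x y
    · exact (le_mul_of_one_le_right' (X.refl y)).trans
        (le_iSup (fun x => φ.1 x * X.str₀ x y) y)
  map_comp {X Y Z} f g := Repr.hom_ext fun φ => Pow.ext fun z => by
    refine (Repr.vMap_apply (f ≫ g) φ z).trans ?_
    refine Eq.trans ?_ (Repr.vMap_apply g (vMap X.toTCat Y.toTCat f.toFun φ) z).symm
    simp only [Repr.vMap_apply, Quantale.iSup_mul_distrib]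
    rw [iSup_comm]
    refine iSup_congr fun x => ?_
    simp only [mul_assoc]
    rw [← Quantale.mul_iSup_distrib]
    congr 1
    apply le_antisymm
    · exact (le_mul_of_one_le_left' (Y.refl (f.toFun x))).trans
        (le_iSup (fun y => Y.str₀ (f.toFun x) y * Z.str₀ (g.toFun y) z) (f.toFun x))
    · exact iSup_le fun y => (mul_le_mul_left (g.isPseudoHom.isTFunctor.le _ _) _).trans
        (Z.str₀_trans _ _ z)

variable (𝕋) in
/-- The Vietoris monad on `Repr(𝕋)`. -/
def vietorisMonad : CategoryTheory.Monad (Repr 𝕋) where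
  toFunctor := vFunctor
  η :=
    { app X := ⟨yoneda X.toTCat, yoneda_isPseudoHom X.isRepresentable⟩
      naturality X Y f := Repr.hom_ext fun x => Pow.ext fun y => by
        refine Eq.trans ?_ (Repr.vMap_apply f (yoneda X.toTCat x) y).symm
        apply le_antisymm
        · exact (le_mul_of_one_le_left' (X.refl x)).trans
            (le_iSup (fun x' => X.str₀ x x' * Y.str₀ (f.toFun x') y) x)
        · exact iSup_le fun x' => (mul_le_mul_left (f.isPseudoHom.isTFunctor.le _ _) _).trans
            (Y.str₀_trans _ _ y) }
  μ :=
    { app X := ⟨vMult X.toTCat, vMult_isPseudoHom X.isRepresentable⟩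
      naturality X Y f := Repr.hom_ext fun Φ => Pow.ext fun y => by
        refine (vMult_apply Y.toTCat _ y).trans ?_
        refine (Repr.vMap_apply (vFunctor.map f) Φ (yoneda Y.toTCat y)).trans ?_
        refine Eq.trans ?_ (Repr.vMap_apply f (vMult X.toTCat Φ) y).symm
        simp only [vMult_apply', Quantale.iSup_mul_distrib]
        rw [iSup_comm]
        refine iSup_congr fun φ => ?_
        have h := str₀_yoneda Y.toTCat ((vFunctor.map f).toFun φ) y
        refine (congrArg _ h).trans ?_
        refine (congrArg _ (Repr.vMap_apply f φ y)).trans ?_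
        simp only [Quantale.mul_iSup_distrib, mul_assoc] }
  assoc X := Repr.hom_ext fun Ψ => Pow.ext fun x => by
    refine (vMult_apply X.toTCat _ x).trans ?_
    refine Eq.trans ?_ (vMult_apply X.toTCat (vMult X.vietoris Ψ) x).symm
    refine Eq.trans ?_ (vMult_apply' X.vietoris Ψ (yoneda X.toTCat x)).symm
    refine (IsPseudoHom.vMap_apply (vMult_isPseudoHom X.isRepresentable)
      (vietoris_isRepresentable (vietoris_isRepresentable X.isRepresentable))
      (vietoris_isRepresentable X.isRepresentable) Ψ (yoneda X.toTCat x)).trans ?_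
    refine iSup_congr fun Φ => ?_
    rw [str₀_yoneda, vMult_apply]
  left_unit X := Repr.hom_ext fun φ => Pow.ext fun x =>
    (vMult_apply X.toTCat _ x).trans (str₀_yoneda X.toTCat φ x)
  right_unit X := Repr.hom_ext fun φ => Pow.ext fun x => by
    refine (vMult_apply X.toTCat _ x).trans ?_
    refine (IsPseudoHom.vMap_apply (yoneda_isPseudoHom X.isRepresentable) X.isRepresentable
      (vietoris_isRepresentable X.isRepresentable) φ (yoneda X.toTCat x)).trans ?_
    simp only [str₀_yoneda]
    apply le_antisymm
    · refine iSup_le fun x' => ?_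
      rw [mul_comm]
      exact Pow.str₀_mul_le φ x' x
    · exact (le_mul_of_one_le_right' (X.refl x)).trans
        (le_iSup (fun x' => φ.1 x' * (yoneda X.toTCat x').1 x) x)

/-- The `V`-relation `(x, y) ↦ r(x)(y)` of a morphism `r : X → VY` of the Kleisli category. -/
def umate {X Y : Kleisli (vietorisMonad 𝕋)} (r : X ⟶ Y) : X.of.carrier → Y.of.carrier → V :=
  fun x y => (r.of.toFun x : Pow Y.of.toTCat).1 y

end

end TopologicalTheory

/-!
A map `r : X → VY` is the same thing as a `V`-relation `ψ : X ⇸ Y` all of whose rows `ψ x` are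
`𝕋`-functors, and `r` is a `𝕋`-functor precisely when `ψ · a ≤ b · T_ξ ψ`. The left adjoint of the
unit of `VY` sends `T r 𝔵` to the row of `b · T_ξ ψ` at `𝔵`. On the other side, representability
of `X` gives `a = a₀ · α`, so that the row of `ψ · a` at `𝔵` is `ψ (α 𝔵)` for a distributor `ψ`.
As `VY` is separated, the condition on `r` to be a pseudo-homomorphism is therefore the equality
`ψ · a = b · T_ξ ψ`. Finally, by the Yoneda lemma the Kleisli composite of `r` and `s` corresponds
to the composite of the `V`-relations.
-/

theorem relComp_eq_self_of_le {V : Type u} [CommMonoid V] [CompleteLattice V] [IsQuantale V]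
    {X Y : Type u} {a : X → X → V} {ψ : X → Y → V} (ha : ∀ x, 1 ≤ a x x)
    (hψ : relComp ψ a ≤ ψ) : relComp ψ a = ψ :=
  le_antisymm hψ fun x _ =>
    (le_mul_of_one_le_left' (ha x)).trans (le_relComp (s := ψ) (r := a) x)

namespace TopologicalTheory

variable {V : Type u} [CommMonoid V] [CompleteLattice V] [IsQuantale V] {𝕋 : TopologicalTheory V}

theorem TCat.IsLeftAdjointUnit.relComp_str {X : TCat 𝕋} {α : 𝕋.F X.carrier → X.carrier}
    (hα : X.IsLeftAdjointUnit α) {Z : Type u} (ψ : X.carrier → Z → V) (𝔵 : 𝕋.F X.carrier) :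
    relComp ψ X.str 𝔵 = relComp ψ X.str₀ (α 𝔵) :=
  funext fun _ => iSup_congr fun x => by rw [hα.str_eq]

theorem isPseudoHom_iff_of_isLeftAdjointUnit {X Y : TCat 𝕋} {f : X.carrier → Y.carrier}
    {α : 𝕋.F X.carrier → X.carrier} {β : 𝕋.F Y.carrier → Y.carrier}
    (hα : X.IsLeftAdjointUnit α) (hβ : Y.IsLeftAdjointUnit β) :
    IsPseudoHom X Y f ↔
      𝕋.IsTFunctor X.str Y.str f ∧ ∀ 𝔵, Y.Equivalent (β (𝕋.map f 𝔵)) (f (α 𝔵)) :=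
  ⟨fun hf => ⟨hf.isTFunctor, hf.equivalent α β hα hβ⟩, fun h => .of_eq h.1 hα hβ h.2⟩

theorem isTFunctor_vStr_iff {X : Type u} {a : 𝕋.F X → X → V} {Y : TCat 𝕋} {r : X → Pow Y} :
    𝕋.IsTFunctor a (vStr Y) r ↔
      relComp (fun x => (r x).1) a ≤ relComp Y.str (𝕋.ext fun x => (r x).1) := by
  refine forall_congr' fun 𝔵 => ?_
  simp only [le_vStr, mu_map, Pi.le_def, relComp, iSup_le_iff]
  exact forall_comm

variable [Subsingleton (𝕋.F PUnit.{u + 1})]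

theorem le_vietoris_str₀_iff {Y : TCat 𝕋} {φ ψ : Pow Y} {v : V} :
    v ≤ Y.vietoris.str₀ φ ψ ↔ ∀ y, v * ψ.1 y ≤ φ.1 y := by
  simp only [under, le_vStr, mu_e]

theorem vietoris_le_iff {Y : TCat 𝕋} {φ ψ : Pow Y} : Y.vietoris.Le φ ψ ↔ ψ.1 ≤ φ.1 := by
  simp only [TCat.Le, le_vietoris_str₀_iff, one_mul, Pi.le_def]

theorem vietoris_equivalent_iff_eq {Y : TCat 𝕋} {φ ψ : Pow Y} :
    Y.vietoris.Equivalent φ ψ ↔ φ = ψ := by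
  rw [TCat.Equivalent, vietoris_le_iff, vietoris_le_iff, and_comm, ← le_antisymm_iff,
    Subtype.ext_iff]

theorem isVDistributor_iff_le_vietoris_str₀ {X : Type u} {a : X → X → V} {Y : TCat 𝕋}
    {r : X → Pow Y} :
    IsVDistributor a Y.str₀ (fun x => (r x).1) ↔ ∀ x x', a x x' ≤ Y.vietoris.str₀ (r x) (r x') := by
  have row_stable : relComp Y.str₀ (fun x => (r x).1) ≤ fun x => (r x).1 := fun x y =>
    iSup_le fun y' => (mul_comm _ _).trans_le ((r x).str₀_mul_le y' y)
  rw [IsVDistributor, and_iff_left row_stable]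
  refine forall_congr' fun x => ?_
  simp only [le_vietoris_str₀_iff, relComp, Pi.le_def, iSup_le_iff]
  exact forall_comm

theorem isTFunctor_homξ_iff_relComp_ext_e_le {X : Type u} {Y : TCat 𝕋} {ψ : X → Y.carrier → V}
    {x : X} : 𝕋.IsTFunctor Y.str 𝕋.homξ (ψ x) ↔ relComp Y.str (𝕋.ext ψ) (𝕋.e x) ≤ ψ x := by
  simp only [isTFunctor_homξ_iff, relComp, Pi.le_def, iSup_le_iff, ext_e, mul_comm]
  exact forall_comm

theorem isPseudoHom_vietoris_iff_of_isLeftAdjointUnit {X Y : TCat 𝕋} {r : X.carrier → Pow Y}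
    {α : 𝕋.F X.carrier → X.carrier} (hα : X.IsLeftAdjointUnit α) (hY : Y.IsRepresentable) :
    IsPseudoHom X Y.vietoris r ↔
      𝕋.IsTFunctor X.str (vStr Y) r ∧
        ∀ 𝔵, relComp Y.str (𝕋.ext fun x => (r x).1) 𝔵 = (r (α 𝔵)).1 := by
  rw [isPseudoHom_iff_of_isLeftAdjointUnit hα (mate_isLeftAdjointUnit hY)]
  simp only [vietoris_equivalent_iff_eq, Subtype.ext_iff, mate, mu_map]

theorem isPseudoHom_vietoris_iff_isReprDist {X Y : TCat 𝕋} (hX : X.IsRepresentable)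
    (hY : Y.IsRepresentable) {r : X.carrier → Pow Y} :
    IsPseudoHom X Y.vietoris r ↔ IsReprDist X Y (fun x => (r x).1) := by
  obtain ⟨α, hα⟩ := hX
  have row_eq (hψ : IsVDistributor X.str₀ Y.str₀ fun x => (r x).1) (𝔵) :
      relComp (fun x => (r x).1) X.str 𝔵 = (r (α 𝔵)).1 :=
    (hα.relComp_str _ 𝔵).trans (congrFun (relComp_eq_self_of_le X.refl hψ.1) (α 𝔵))
  rw [isPseudoHom_vietoris_iff_of_isLeftAdjointUnit hα hY]
  constructor
  · rintro ⟨hr, hrα⟩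
    have hψ : IsVDistributor X.str₀ Y.str₀ fun x => (r x).1 :=
      isVDistributor_iff_le_vietoris_str₀.2 (IsTFunctor.le (Y := Y.vietoris) hr)
    exact ⟨hψ, funext fun 𝔵 => (row_eq hψ 𝔵).trans (hrα 𝔵).symm⟩
  · rintro ⟨hψ, comm⟩
    exact ⟨isTFunctor_vStr_iff.2 comm.le,
      fun 𝔵 => (congrFun comm 𝔵).symm.trans (row_eq hψ 𝔵)⟩

theorem IsReprDist.isTFunctor_homξ {X Y : TCat 𝕋} {ψ : X.carrier → Y.carrier → V}
    (hψ : IsReprDist X Y ψ) (x : X.carrier) : 𝕋.IsTFunctor Y.str 𝕋.homξ (ψ x) := by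
  rw [isTFunctor_homξ_iff_relComp_ext_e_le, ← hψ.comm]
  exact hψ.isVDistributor.1 x

/-- The transpose `X → VY` of a morphism `ψ : X ⇸ Y` of `ReprDist(𝕋)`, sending `x` to the row
`ψ x`. -/
def IsReprDist.toPow {X Y : TCat 𝕋} {ψ : X.carrier → Y.carrier → V} (hψ : IsReprDist X Y ψ)
    (x : X.carrier) : Pow Y :=
  ⟨ψ x, hψ.isTFunctor_homξ x⟩

theorem umate_isReprDist {X Y : Kleisli (vietorisMonad 𝕋)} (r : X ⟶ Y) :
    IsReprDist X.of.toTCat Y.of.toTCat (umate r) :=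
  (isPseudoHom_vietoris_iff_isReprDist X.of.isRepresentable Y.of.isRepresentable).1
    r.of.isPseudoHom

theorem umate_id (X : Kleisli (vietorisMonad 𝕋)) : umate (𝟙 X) = X.of.str₀ := rfl

theorem umate_comp {X Y Z : Kleisli (vietorisMonad 𝕋)} (r : X ⟶ Y) (s : Y ⟶ Z) :
    umate (r ≫ s) = relComp (umate s) (umate r) := by
  funext x z
  let sr : Pow Z.of.toTCat.vietoris := (vFunctor.map s.of).toFun (r.of.toFun x)
  calc umate (r ≫ s) x z
      = sr.1 (yoneda Z.of.toTCat z) := vMult_apply Z.of.toTCat sr z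
    _ = ⨆ y, umate r x y * Z.of.toTCat.vietoris.str₀ (s.of.toFun y) (yoneda Z.of.toTCat z) :=
        Repr.vMap_apply s.of _ _
    _ = relComp (umate s) (umate r) x z :=
        iSup_congr fun y => congrArg (umate r x y * ·) (str₀_yoneda Z.of.toTCat (s.of.toFun y) z)

variable (𝕋) in
/-- The comparison functor from the Kleisli category of the Vietoris monad to `ReprDist(𝕋)`, sending
`r : X → VY` to the `V`-relation `(x, y) ↦ r(x)(y)`. -/
def kleisliToReprDist : Kleisli (vietorisMonad 𝕋) ⥤ ReprDist 𝕋 where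
  obj X := ⟨X.of⟩
  map r := ⟨umate r, umate_isReprDist r⟩
  map_id X := ReprDist.Hom.ext (umate_id X)
  map_comp r s := ReprDist.Hom.ext (umate_comp r s)

variable (𝕋) in
/-- The comparison functor is fully faithful; its inverse on morphisms is transposition. -/
def kleisliToReprDistFullyFaithful : (kleisliToReprDist 𝕋).FullyFaithful where
  preimage {X Y} ψ :=
    ⟨ψ.isReprDist.toPow,
      (isPseudoHom_vietoris_iff_isReprDist X.of.isRepresentable Y.of.isRepresentable).2
        ψ.isReprDist⟩
  map_preimage _ := rfl
  preimage_map _ := rfl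

instance : (kleisliToReprDist 𝕋).IsEquivalence where
  full := (kleisliToReprDistFullyFaithful 𝕋).full
  faithful := (kleisliToReprDistFullyFaithful 𝕋).faithful
  essSurj := ⟨fun X => ⟨.mk _ X.of, ⟨Iso.refl X⟩⟩⟩

end TopologicalTheory

theorem mainTheorem3 {V : Type u} [CommMonoid V] [CompleteLattice V] [IsQuantale V]
    (𝕋 : TopologicalTheory V) [Subsingleton (𝕋.F PUnit.{u + 1})] :
    ∃ (E : Kleisli 𝕋.vietorisMonad ≌ 𝕋.ReprDist)
      (h : ∀ X : Kleisli 𝕋.vietorisMonad, E.functor.obj X = TopologicalTheory.ReprDist.mk X.of),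
      ∀ (X Y : Kleisli 𝕋.vietorisMonad) (r : X ⟶ Y) (x : X.of.carrier) (y : Y.of.carrier),
        (eqToHom (h X).symm ≫ E.functor.map r ≫ eqToHom (h Y)).rel x y =
          TopologicalTheory.umate r x y := by
  refine ⟨𝕋.kleisliToReprDist.asEquivalence, fun _ => rfl, fun X Y r x y => ?_⟩
  have map_eq : 𝟙 _ ≫ 𝕋.kleisliToReprDist.map r ≫ 𝟙 _ = 𝕋.kleisliToReprDist.map r := by
    rw [Category.id_comp, Category.comp_id]
  exact congrFun₂ (congrArg TopologicalTheory.ReprDist.Hom.rel map_eq) x y
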